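/- A ribbon graph $G$ is a surface with boundary presented as a finite union of closed discs, the vertex-discs $V(G)$ and the edge-ribbons $E(G)$, which meet in disjoint line segments, each lying on the boundary of exactly one vertex-disc and one edge-ribbon, every edge-ribbon containing exactly two of them (its half-edges). Ribbon graphs are described by signed rotation systems: a cyclic ordering of the half-edges at each vertex-disc and a sign $\pm$ on each half-edge, an edge being twisted if its two half-edges carry opposite signs and untwisted otherwise. Let $F(G)$ be the set of boundary components of $G$, $c(G)$ its number of connected components, $\chi(G)=|V(G)|-|E(G)|+|F(G)|$, and let $\varepsilon(G)=2c(G)-\chi(G)$ be its Euler genus. For $A\subseteq E(G)$, the partial Petrial $G^{\times|A}$ is obtained by detaching one end of each edge-ribbon in $A$, giving the edge-ribbon a twist, and reattaching the end at the same place. A bouquet is a ribbon graph $B$ with exactly one vertex. The signed intersection graph $SI(B)$ has vertex set $E(B)$; two distinct edges are adjacent if their half-edges alternate in the cyclic ordering at the vertex; a vertex has sign $+$ if the corresponding loop is untwisted and $-$ if it is twisted. Its adjacency matrix $\mathrm{adj}(SI(B))$ over $\mathrm{GF}(2)$ is the adjacency matrix of the underlying simple graph with the diagonal entries at the vertices of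 sign $-$ replaced by $1$. The modified partial Petrial polynomial of $B$ is $${}^{M\partial}\varepsilon^{\times}_{B}(z)=\sum_{A\subseteq E(B)}(-1)^{|A|}z^{\varepsilon(B^{\times|A})}.$$ **Theorem.** For every bouquet $B$, $${}^{M\partial}\varepsilon^{\times}_{B}(z)=\sum_{A\subseteq E(B)}(-1)^{|A|}z^{\mathrm{rank}(\mathrm{adj}(SI(B^{\times|A})))},$$ where the rank is taken over $\mathrm{GF}(2)$. Moreover the equality holds term by term: $\varepsilon(B^{\times|A})=\mathrm{rank}(\mathrm{adj}(SI(B^{\times|A})))$ for every $A\subseteq E(B)$. -/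

import Mathlib

open Polynomial

/-- A ribbon graph with vertex-discs `V` and edge-ribbons `E`, given by its signed rotation
system. The two half-edges (ends) of the edge-ribbon `e` are `(e, false)` and `(e, true)`.
At each vertex-disc there is a cyclic ordering of the half-edges attached to it (empty if the
vertex-disc is isolated); each half-edge is attached at exactly one place, and carries a sign. -/
structure RibbonGraph (V E : Type*) where
  rot : V → Cycle (E × Bool)
  nodup_rot : ∀ v, (rot v).Nodup
  existsUnique_mem_rot : ∀ h : E × Bool, ∃! v, h ∈ rot v
  sign : E × Bool → ℤˣ

/-- A simple signed graph: a simple graph whose vertices are labelled with `+` or `-`. -/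
structure SimpleSignedGraph (W : Type*) where
  graph : SimpleGraph W
  sign : W → ℤˣ

open Classical in
/-- The adjacency matrix over `GF(2)` of a simple signed graph: the adjacency matrix of the
underlying simple graph, with diagonal entry `1` at each vertex of sign `-`. -/
noncomputable def SimpleSignedGraph.adj {W : Type*} (S : SimpleSignedGraph W) :
    Matrix W W (ZMod 2) :=
  S.graph.adjMatrix (ZMod 2) + Matrix.diagonal (fun w => if S.sign w = -1 then 1 else 0)

namespace RibbonGraph

variable {V E : Type*}

/-- A bouquet is a ribbon graph with exactly one vertex. -/
def IsBouquet (_G : RibbonGraph V E) : Prop := Nat.card V = 1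

/-- An edge-ribbon is twisted if its two half-edges carry opposite signs. -/
def IsTwisted (G : RibbonGraph V E) (e : E) : Prop := G.sign (e, false) ≠ G.sign (e, true)

/-- The partial Petrial with respect to `A`: one end of each edge-ribbon in `A` is detached,
the edge-ribbon is given a twist, and the end is reattached at the same place. -/
def partialPetrial [DecidableEq E] (G : RibbonGraph V E) (A : Finset E) : RibbonGraph V E where
  rot := G.rot
  nodup_rot := G.nodup_rot
  existsUnique_mem_rot := G.existsUnique_mem_rot
  sign := fun h => if h.1 ∈ A ∧ h.2 = true then -G.sign h else G.sign h

/-- The half-edge `h` is attached to its vertex-disc along a segment with two end points: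
`(h, false)`, the first one met, and `(h, true)`, the last one met, when the boundary of the
vertex-disc is traversed in the direction of its cyclic ordering. The boundary of the surface
consists of arcs between these points (and of the whole boundaries of isolated vertex-discs):
* an arc of the boundary of a vertex-disc from the last point of a half-edge to the first point of
  the next half-edge;
* the two free sides of each edge-ribbon. An untwisted edge-ribbon (a band attached compatibly with
  the orientations of the vertex-discs at its ends) joins first points to last points; a twisted one
  joins first to first and last to last.
`BoundaryArc p q` says that there is such an arc between `p` and `q`. -/
inductive BoundaryArc [DecidableEq E] (G : RibbonGraph V E) :
    (E × Bool) × Bool → (E × Bool) × Bool → Prop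
  | corner (v : V) (h : E × Bool) (hv : h ∈ G.rot v) :
      BoundaryArc G (h, true) ((G.rot v).next (G.nodup_rot v) h hv, false)
  | untwistedSide (e : E) (s : Bool) (he : ¬ G.IsTwisted e) :
      BoundaryArc G ((e, false), s) ((e, true), !s)
  | twistedSide (e : E) (s : Bool) (he : G.IsTwisted e) :
      BoundaryArc G ((e, false), s) ((e, true), s)

/-- The faces, i.e. the boundary components of the surface: the closed curves formed by the boundary
arcs, and one further component for each isolated vertex-disc. -/
abbrev Face [DecidableEq E] (G : RibbonGraph V E) : Type _ :=
  Quot G.BoundaryArc ⊕ {v : V // G.rot v = Cycle.nil}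

/-- The connected components, as classes of vertex-discs. -/
abbrev Component (G : RibbonGraph V E) : Type _ :=
  Quot (fun u v : V => ∃ e : E, (e, false) ∈ G.rot u ∧ (e, true) ∈ G.rot v)

/-- The Euler characteristic `|V(G)| - |E(G)| + |F(G)|`. -/
noncomputable def eulerChar [DecidableEq E] (G : RibbonGraph V E) : ℤ :=
  (Nat.card V : ℤ) - (Nat.card E : ℤ) + (Nat.card G.Face : ℤ)

/-- The Euler genus `2 c(G) - χ(G)`. -/
noncomputable def eulerGenus [DecidableEq E] (G : RibbonGraph V E) : ℤ :=
  2 * (Nat.card G.Component : ℤ) - G.eulerChar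

/-- Two edges are interlaced if their half-edges alternate in the rotation at a vertex. (In a
bouquet this is the rotation at the only vertex.) -/
def Interlaced (G : RibbonGraph V E) (a b : E) : Prop :=
  a ≠ b ∧ ∃ (v : V) (l : List (E × Bool)) (i j : Bool), G.rot v = (l : Cycle (E × Bool)) ∧
    List.Sublist [(a, i), (b, j), (a, !i), (b, !j)] l

theorem Interlaced.symm {G : RibbonGraph V E} {a b : E} (h : G.Interlaced a b) :
    G.Interlaced b a := by
  obtain ⟨hab, v, l, i, j, hl, hs⟩ := h
  obtain ⟨l₁, l₂, rfl, h₁, h₂⟩ := List.cons_sublist_iff.1 hs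
  obtain ⟨s, t, rfl⟩ := List.append_of_mem h₁
  refine ⟨hab.symm, v, (t ++ l₂) ++ (s ++ [(a, i)]), j, !i, ?_, ?_⟩
  · rw [hl, Cycle.coe_eq_coe]
    have := List.isRotated_append (l := s ++ [(a, i)]) (l' := t ++ l₂)
    simpa using this
  · have h₃ : List.Sublist [(b, j), (a, !i), (b, !j)] (t ++ l₂) :=
      h₂.trans (List.sublist_append_right _ _)
    have h₄ : List.Sublist [(a, i)] (s ++ [(a, i)]) := List.sublist_append_right _ _
    simpa using h₃.append h₄

/-- The intersection graph: vertices are the edges of `G`, adjacent when interlaced. -/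
def intersectionGraph (G : RibbonGraph V E) : SimpleGraph E where
  Adj := G.Interlaced
  symm := ⟨fun _ _ h => h.symm⟩
  loopless := ⟨fun _ h => h.1 rfl⟩

open Classical in
/-- The signed intersection graph: an untwisted loop has sign `+`, a twisted loop sign `-`. -/
noncomputable def signedIntersectionGraph (G : RibbonGraph V E) : SimpleSignedGraph E where
  graph := G.intersectionGraph
  sign := fun e => if G.IsTwisted e then -1 else 1

/-- The modified partial Petrial polynomial: the sum over all sets `A` of edges of
`(-1) ^ card A * z ^ ε(A)`, where `ε(A)` is the Euler genus of the partial Petrial at `A`. -/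
noncomputable def modifiedPartialPetrialPolynomial [Fintype E] [DecidableEq E]
    (G : RibbonGraph V E) : ℤ[X] :=
  ∑ A : Finset E, (-1) ^ A.card * X ^ (G.partialPetrial A).eulerGenus.toNat

end RibbonGraph

/-! Colour the boundary components by elements of GF(2) and record, for each edge-ribbon, the
difference of the colours of its two sides. For a bouquet with at least one edge this linear map has
the constants as kernel (`finrank_ker_sideDifference`) and the kernel of the adjacency matrix as
image (`sideDifference_mem_ker`, `exists_sideDifference_eq`). Rank-nullity, applied to this map and
to the matrix, gives |F| + rank = |E| + 1, and with one vertex and one component the Euler genus is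
1 + |E| - |F|, hence the rank. A partial Petrial of a bouquet is again a bouquet, so this applies to
each term. -/

namespace RibbonGraph

/-! ### Alternating pairs in a linear order of the half-edges -/

/-- The ends of `a` and `b` alternate in the linear order of the half-edges given by the
positions `p`. -/
def Alternates {E : Type*} (p : E × Bool → ℕ) (a b : E) : Prop :=
  ∃ i j : Bool, (p (a, i) < p (b, j) ∧ p (b, j) < p (a, !i) ∧ p (a, !i) < p (b, !j)) ∨
    (p (b, j) < p (a, i) ∧ p (a, i) < p (b, !j) ∧ p (b, !j) < p (a, !i))

theorem _root_.List.Nodup.pairwise_idxOf_lt {α : Type*} [BEq α] [LawfulBEq α] {l : List α}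
    (hl : l.Nodup) : l.Pairwise (fun a b => l.idxOf a < l.idxOf b) := by
  rw [List.pairwise_iff_getElem]
  intro i j hi hj hij
  rwa [hl.idxOf_getElem, hl.idxOf_getElem]

theorem _root_.List.Nodup.sublist_iff_pairwise_idxOf_lt {α : Type*} [BEq α] [LawfulBEq α]
    {l s : List α} (hl : l.Nodup) (hs : s ⊆ l) :
    s.Sublist l ↔ s.Pairwise (fun a b => l.idxOf a < l.idxOf b) := by
  refine ⟨fun h => hl.pairwise_idxOf_lt.sublist h, fun h => ?_⟩
  have : Std.Antisymm (fun a b => l.idxOf a < l.idxOf b) := ⟨fun a b h h' => by omega⟩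
  have hn : s.Nodup := h.imp fun {a b} hab e => by subst e; omega
  exact List.sublist_of_subperm_of_pairwise (hn.subperm hs) h hl.pairwise_idxOf_lt

/-- The ends of `a` and `b` alternate in the list `l`. -/
def AlternatesIn {E : Type*} (l : List (E × Bool)) (a b : E) : Prop :=
  ∃ i j : Bool, List.Sublist [(a, i), (b, j), (a, !i), (b, !j)] l ∨
    List.Sublist [(b, j), (a, i), (b, !j), (a, !i)] l

/-- Moving the leading half-edge to the end turns a pattern starting with `a` into one starting with
`b`, and conversely; both patterns are allowed for this reason. -/
theorem AlternatesIn.rotate_one {E : Type*} {c : E × Bool} {t : List (E × Bool)} {a b : E}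
    (h : AlternatesIn (c :: t) a b) : AlternatesIn (t ++ [c]) a b := by
  obtain ⟨i, j, h | h⟩ := h
  · cases h with
    | cons _ h => exact ⟨i, j, Or.inl (h.trans (List.sublist_append_left _ _))⟩
    | cons_cons _ h => exact ⟨!i, j, Or.inr (by simpa using h.append (List.Sublist.refl [(a, i)]))⟩
  · cases h with
    | cons _ h => exact ⟨i, j, Or.inr (h.trans (List.sublist_append_left _ _))⟩
    | cons_cons _ h => exact ⟨i, !j, Or.inl (by simpa using h.append (List.Sublist.refl [(b, j)]))⟩

theorem AlternatesIn.isRotated {E : Type*} {l l' : List (E × Bool)} {a b : E}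
    (h : AlternatesIn l a b) (hl : l ~r l') : AlternatesIn l' a b := by
  obtain ⟨n, rfl⟩ := hl
  induction n generalizing l with
  | zero => simpa using h
  | succ n ih =>
    cases l with
    | nil => simpa using h
    | cons c t => simpa using ih h.rotate_one

theorem alternatesIn_iff {E : Type*} [DecidableEq E] {l : List (E × Bool)} (hl : l.Nodup)
    (hall : ∀ h, h ∈ l) (a b : E) : AlternatesIn l a b ↔ Alternates (fun h => l.idxOf h) a b := by
  unfold AlternatesIn Alternates
  refine exists_congr fun i => exists_congr fun j => or_congr ?_ ?_
  all_goals
    rw [hl.sublist_iff_pairwise_idxOf_lt fun h _ => hall h]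
    simp only [List.pairwise_cons, List.mem_cons, List.not_mem_nil, or_false, forall_eq_or_imp,
      forall_eq, false_imp_iff, implies_true, and_true, List.Pairwise.nil]
    omega

/-- Counts modulo 2 the pairs in which an end of `b` precedes an end of `a`; a check over the orders
of four distinct positions. -/
theorem alternates_parity {E : Type*} {p : E × Bool → ℕ} (hp : Function.Injective p) {a b : E}
    (hab : a ≠ b) [Decidable (Alternates p a b)] :
    ((if p (b, false) < p (a, false) then 1 else 0) + (if p (b, true) < p (a, false) then 1 else 0)
      + (if p (b, false) < p (a, true) then 1 else 0)
      + (if p (b, true) < p (a, true) then 1 else 0) : ZMod 2)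
      = if Alternates p a b then 1 else 0 := by
  have h1 : p (a, false) ≠ p (b, false) := fun h => hab (by simpa using hp h)
  have h2 : p (a, false) ≠ p (b, true) := fun h => by simpa using hp h
  have h3 : p (a, true) ≠ p (b, false) := fun h => by simpa using hp h
  have h4 : p (a, true) ≠ p (b, true) := fun h => hab (by simpa using hp h)
  by_cases hA : Alternates p a b
  all_goals
    simp only [hA, if_true, if_false]
    simp only [Alternates, Bool.exists_bool, Bool.not_true, Bool.not_false] at hA
    generalize p (a, false) = a0 at *
    generalize p (a, true) = a1 at *
    generalize p (b, false) = b0 at *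
    generalize p (b, true) = b1 at *
    split_ifs <;> first | decide | omega

/-! ### Partial sums along the rotation -/

/-- The sum of the weights of the half-edges at positions less than `k`. -/
def partialSum {E : Type*} [Fintype E] (p : E × Bool → ℕ) (x : E → ZMod 2) (k : ℕ) : ZMod 2 :=
  ∑ g : E × Bool, if p g < k then x g.1 else 0

section PartialSum

variable {E : Type*} [Fintype E] {p : E × Bool → ℕ} (x : E → ZMod 2)

theorem partialSum_zero : partialSum p x 0 = 0 := by simp [partialSum]

theorem partialSum_succ (hp : Function.Injective p) (h : E × Bool) :
    partialSum p x (p h + 1) = partialSum p x (p h) + x h.1 := by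
  classical
  have : x h.1 = ∑ g : E × Bool, if g = h then x g.1 else 0 := by simp
  rw [this, partialSum, partialSum, ← Finset.sum_add_distrib]
  refine Finset.sum_congr rfl fun g _ => ?_
  by_cases hg : g = h
  · simp [hg]
  · have : p g ≠ p h := fun e => hg (hp e)
    by_cases hlt : p g < p h
    · simp [hg, hlt, Nat.lt_succ_of_lt hlt]
    · have : ¬ p g < p h + 1 := by omega
      simp [hg, hlt, this]

/-- Each edge is counted once per end, so a full turn contributes zero. -/
theorem partialSum_of_forall_lt {k : ℕ} (hk : ∀ g, p g < k) : partialSum p x k = 0 := by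
  simp [partialSum, hk, Fintype.sum_prod_type, ← two_mul, CharTwo.two_eq_zero]

open Classical in
theorem partialSum_add_partialSum (hp : Function.Injective p) (e : E) :
    partialSum p x (p (e, false)) + partialSum p x (p (e, true)) =
      x e + ∑ b, if e ≠ b ∧ Alternates p e b then x b else 0 := by
  have : x e = ∑ b, if b = e then x b else 0 := by simp
  rw [this, partialSum, partialSum, ← Finset.sum_add_distrib, ← Finset.sum_add_distrib,
    Fintype.sum_prod_type]
  refine Finset.sum_congr rfl fun b _ => ?_
  simp only [Fintype.sum_bool]
  by_cases hb : b = e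
  -- The edge's own contribution: its earlier end precedes the later one, and only that pair counts.
  · subst hb
    have hne : p (b, false) ≠ p (b, true) := fun h => by simpa using hp h
    rcases lt_or_gt_of_ne hne with h | h
    · simp [h, h.le]
    · simp [h, h.le]
  · have hb' : e ≠ b := fun h => hb h.symm
    have := congrArg (· * x b) (alternates_parity hp hb')
    simp only [add_mul, ite_mul, one_mul, zero_mul] at this
    simp only [hb, if_false, zero_add, ne_eq, hb', not_false_eq_true, true_and]
    rw [← this]
    ring

end PartialSum

theorem next_getElem_of_eq_coe {α : Type*} [DecidableEq α] {c : Cycle α} {l : List α}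
    (h : c = l) (hl : l.Nodup) {k : ℕ} (hk : k < l.length) {hc : c.Nodup} {hm : l[k] ∈ c} :
    c.next hc l[k] hm = l[(k + 1) % l.length]'(Nat.mod_lt _ (by omega)) := by
  subst h
  exact List.next_getElem l hl k hk

/-! ### Boundary components of a bouquet -/

variable {V E : Type*}

theorem interlaced_iff_of_bouquet [DecidableEq E] (G : RibbonGraph V E) [Subsingleton V] (v : V)
    {l : List (E × Bool)} (hv : G.rot v = l) (hl : l.Nodup) (hall : ∀ h, h ∈ l) (a b : E) :
    G.Interlaced a b ↔ a ≠ b ∧ Alternates (fun h => l.idxOf h) a b := by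
  rw [← alternatesIn_iff hl hall]
  refine and_congr_right fun hab => ⟨?_, ?_⟩
  · rintro ⟨w, l', i, j, hw, hs⟩
    obtain rfl := Subsingleton.elim v w
    refine AlternatesIn.isRotated (l := l') ⟨i, j, Or.inl hs⟩ ?_
    rw [← Cycle.coe_eq_coe, ← hw, hv]
  · rintro ⟨i, j, hs | hs⟩
    · exact ⟨v, l, i, j, hv, hs⟩
    · have : G.Interlaced b a := ⟨hab.symm, v, l, j, i, hv, hs⟩
      exact this.symm.2

open Classical in
theorem adj_signedIntersectionGraph_mulVec [Fintype E] (G : RibbonGraph V E) (x : E → ZMod 2)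
    (e : E) :
    (G.signedIntersectionGraph.adj.mulVec x) e =
      (∑ b, if G.Interlaced e b then x b else 0) + if G.IsTwisted e then x e else 0 := by
  rw [SimpleSignedGraph.adj, Matrix.add_mulVec, Pi.add_apply, Matrix.mulVec_diagonal]
  congr 1
  · refine Finset.sum_congr rfl fun b _ => ?_
    change SimpleGraph.adjMatrix (ZMod 2) G.intersectionGraph e b * x b = _
    rw [SimpleGraph.adjMatrix_apply, ite_mul, one_mul, zero_mul]
    rfl
  · by_cases h : G.IsTwisted e <;> simp [signedIntersectionGraph, h]

/-! ### Colourings of the boundary components -/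

section Faces

variable [DecidableEq E] (G : RibbonGraph V E)

/-- The difference of a colouring of the boundary components across each edge-ribbon. -/
def sideDifference : (Quot G.BoundaryArc → ZMod 2) →ₗ[ZMod 2] (E → ZMod 2) where
  toFun f e := f (Quot.mk _ ((e, false), false)) + f (Quot.mk _ ((e, false), true))
  map_add' f g := by ext e; simp only [Pi.add_apply]; ring
  map_smul' c f := by ext e; simp only [Pi.smul_apply, smul_eq_mul, RingHom.id_apply]; ring

variable {G}

theorem mk_untwisted {e : E} (he : ¬ G.IsTwisted e) (s : Bool) :
    Quot.mk G.BoundaryArc ((e, true), s) = Quot.mk _ ((e, false), !s) := by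
  simpa using (Quot.sound (BoundaryArc.untwistedSide e (!s) he)).symm

theorem mk_twisted {e : E} (he : G.IsTwisted e) (s : Bool) :
    Quot.mk G.BoundaryArc ((e, true), s) = Quot.mk _ ((e, false), s) :=
  (Quot.sound (BoundaryArc.twistedSide e s he)).symm

/-- Both ends of a ribbon see the same two sides, perhaps swapped, and in characteristic 2 the
difference is symmetric. -/
theorem apply_mk_true (f : Quot G.BoundaryArc → ZMod 2) (h : E × Bool) :
    f (Quot.mk _ (h, true)) = f (Quot.mk _ (h, false)) + G.sideDifference f h.1 := by
  obtain ⟨e, s⟩ := h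
  have aux : ∀ a b : ZMod 2, b = a + (a + b) ∧ b = a + (b + a) := by decide
  cases s
  · exact (aux _ _).1
  · by_cases he : G.IsTwisted e
    · rw [mk_twisted he, mk_twisted he]
      exact (aux _ _).1
    · rw [mk_untwisted he, mk_untwisted he]
      exact (aux _ _).2

variable {v : V} {l : List (E × Bool)}

theorem mk_getElem_succ (hv : G.rot v = l) (hl : l.Nodup) {k : ℕ} (hk : k < l.length) :
    Quot.mk G.BoundaryArc (l[k], true) = Quot.mk _ (l[(k + 1) % l.length]'
      (Nat.mod_lt _ (by omega)), false) := by
  have hmem : l[k] ∈ G.rot v := by rw [hv]; exact List.getElem_mem hk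
  rw [Quot.sound (BoundaryArc.corner v l[k] hmem), next_getElem_of_eq_coe hv hl]

variable [Fintype E]

/-- Walking along the vertex-disc, the colour is constant on corners and changes by the side
difference at each half-edge passed. -/
theorem apply_mk_false (hv : G.rot v = l) (hl : l.Nodup) (hall : ∀ h, h ∈ l) (h₀ : 0 < l.length)
    (f : Quot G.BoundaryArc → ZMod 2) (h : E × Bool) :
    f (Quot.mk _ (h, false)) = f (Quot.mk _ (l[0], false)) +
      partialSum (fun h => l.idxOf h) (G.sideDifference f) (l.idxOf h) := by
  suffices H : ∀ k (hk : k < l.length), f (Quot.mk _ (l[k], false)) =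
      f (Quot.mk _ (l[0], false)) + partialSum (fun h => l.idxOf h) (G.sideDifference f) k by
    have := H (l.idxOf h) (List.idxOf_lt_length_iff.2 (hall h))
    rwa [List.getElem_idxOf] at this
  intro k
  induction k with
  | zero => intro _; rw [partialSum_zero, add_zero]
  | succ k ih =>
    intro hk
    have hinj : Function.Injective (fun h => l.idxOf h) := fun a b hab =>
      (List.idxOf_inj (hall a)).1 hab
    have h1 := mk_getElem_succ hv hl (k := k) (by omega)
    simp only [Nat.mod_eq_of_lt hk] at h1
    have h2 := partialSum_succ (G.sideDifference f) hinj l[k]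
    simp only [hl.idxOf_getElem] at h2
    rw [← h1, apply_mk_true f, ih (by omega), h2, add_assoc]

theorem finrank_ker_sideDifference (hv : G.rot v = l) (hl : l.Nodup) (hall : ∀ h, h ∈ l)
    (h₀ : 0 < l.length) : Module.finrank (ZMod 2) (LinearMap.ker G.sideDifference) = 1 := by
  have hone : (1 : Quot G.BoundaryArc → ZMod 2) ≠ 0 := fun h =>
    one_ne_zero (congrFun h (Quot.mk _ (l[0], false)))
  have : LinearMap.ker G.sideDifference = Submodule.span (ZMod 2) {1} := by
    ext f
    rw [LinearMap.mem_ker, Submodule.mem_span_singleton]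
    constructor
    · intro hf
      refine ⟨f (Quot.mk _ (l[0], false)), ?_⟩
      ext q
      obtain ⟨⟨h, s⟩, rfl⟩ := Quot.exists_rep q
      have h1 := apply_mk_false hv hl hall h₀ f h
      have h2 := apply_mk_true f h
      have h3 : partialSum (fun h => l.idxOf h) (0 : E → ZMod 2) (l.idxOf h) = 0 := by
        simp [partialSum]
      rw [hf, h3, add_zero] at h1
      rw [hf, Pi.zero_apply, add_zero] at h2
      cases s <;> simp [h2, h1]
    · rintro ⟨c, rfl⟩
      ext e
      simp [sideDifference, CharTwo.add_self_eq_zero]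
  rw [this, finrank_span_singleton hone]

variable [Subsingleton V]

/-- The first points of the two ends of `e` have equal colours if `e` is twisted, and colours
differing by the side difference if not. Comparing with the partial sums gives row `e` of the
system. -/
theorem sideDifference_mem_ker (hv : G.rot v = l) (hl : l.Nodup) (hall : ∀ h, h ∈ l)
    (h₀ : 0 < l.length) (f : Quot G.BoundaryArc → ZMod 2) :
    G.signedIntersectionGraph.adj.mulVec (G.sideDifference f) = 0 := by
  classical
  have hinj : Function.Injective (fun h => l.idxOf h) := fun a b hab =>
    (List.idxOf_inj (hall a)).1 hab
  ext e
  rw [adj_signedIntersectionGraph_mulVec]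
  simp only [interlaced_iff_of_bouquet G v hv hl hall, Pi.zero_apply]
  have key := partialSum_add_partialSum (G.sideDifference f) hinj e
  have h1 := apply_mk_false hv hl hall h₀ f (e, false)
  have h2 := apply_mk_false hv hl hall h₀ f (e, true)
  have h3 := apply_mk_true f (e, false)
  by_cases he : G.IsTwisted e
  · rw [mk_twisted he] at h2
    simp only [he, if_true]
    grind
  · rw [mk_untwisted he, Bool.not_false] at h2
    simp only [he, if_false, add_zero]
    grind

theorem exists_sideDifference_eq (hv : G.rot v = l) (hl : l.Nodup) (hall : ∀ h, h ∈ l)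
    {x : E → ZMod 2} (hx : G.signedIntersectionGraph.adj.mulVec x = 0) :
    ∃ f : Quot G.BoundaryArc → ZMod 2, G.sideDifference f = x := by
  classical
  have hinj : Function.Injective (fun h => l.idxOf h) := fun a b hab =>
    (List.idxOf_inj (hall a)).1 hab
  -- The colour forced by `apply_mk_false` and `apply_mk_true`, normalised to 0 at the start of the
  -- list.
  let F : (E × Bool) × Bool → ZMod 2 := fun q =>
    partialSum (fun h => l.idxOf h) x (l.idxOf q.1) + if q.2 then x q.1.1 else 0
  have hker : ∀ e, partialSum (fun h => l.idxOf h) x (l.idxOf (e, false)) +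
      partialSum (fun h => l.idxOf h) x (l.idxOf (e, true)) =
        x e + if G.IsTwisted e then x e else 0 := by
    intro e
    have h := congrFun hx e
    rw [adj_signedIntersectionGraph_mulVec] at h
    simp only [interlaced_iff_of_bouquet G v hv hl hall, Pi.zero_apply] at h
    rw [partialSum_add_partialSum x hinj e]
    grind
  have hF : ∀ q r, G.BoundaryArc q r → F q = F r := by
    intro q r hqr
    cases hqr with
    | corner w h hw =>
      obtain rfl := Subsingleton.elim v w
      obtain ⟨k, hk, rfl⟩ := List.mem_iff_getElem.1 (hall h)
      rw [next_getElem_of_eq_coe hv hl]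
      have h2 := partialSum_succ x hinj l[k]
      simp only [hl.idxOf_getElem] at h2
      simp only [F, hl.idxOf_getElem, if_true, ← h2]
      rcases Nat.lt_or_ge (k + 1) l.length with hlt | hge
      · simp [Nat.mod_eq_of_lt hlt]
      -- The corner closing the cycle: the total over all half-edges must vanish.
      · have : k + 1 = l.length := by omega
        simp only [this, Nat.mod_self, partialSum_zero]
        rw [partialSum_of_forall_lt]
        · simp
        · exact fun g => List.idxOf_lt_length_iff.2 (hall g)
    | untwistedSide e s he =>
      have := hker e
      cases s <;> simp [F, he] at this ⊢ <;> grind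
    | twistedSide e s he =>
      have := hker e
      cases s <;> simp [F, he] at this ⊢ <;> grind
  refine ⟨Quot.lift F hF, ?_⟩
  ext e
  simp only [sideDifference, LinearMap.coe_mk, AddHom.coe_mk, F]
  grind

theorem card_boundary_add_rank (hv : G.rot v = l) (hl : l.Nodup) (hall : ∀ h, h ∈ l)
    (h₀ : 0 < l.length) :
    Nat.card (Quot G.BoundaryArc) + G.signedIntersectionGraph.adj.rank = Nat.card E + 1 := by
  classical
  have := Fintype.ofFinite (Quot G.BoundaryArc)
  have h1 := LinearMap.finrank_range_add_finrank_ker G.sideDifference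
  have h2 := LinearMap.finrank_range_add_finrank_ker G.signedIntersectionGraph.adj.mulVecLin
  have h3 : LinearMap.range G.sideDifference =
      LinearMap.ker G.signedIntersectionGraph.adj.mulVecLin := by
    ext x
    rw [LinearMap.mem_range, LinearMap.mem_ker, Matrix.mulVecLin_apply]
    refine ⟨?_, exists_sideDifference_eq hv hl hall⟩
    rintro ⟨f, rfl⟩
    exact sideDifference_mem_ker hv hl hall h₀ f
  rw [finrank_ker_sideDifference hv hl hall h₀, h3, Module.finrank_fintype_fun_eq_card] at h1
  rw [Module.finrank_fintype_fun_eq_card] at h2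
  rw [Nat.card_eq_fintype_card, Nat.card_eq_fintype_card, Matrix.rank]
  omega

end Faces

/-! ### Face count and Euler genus -/

theorem card_face_add_rank [Fintype E] [DecidableEq E] (G : RibbonGraph V E)
    (hG : G.IsBouquet) :
    Nat.card G.Face + G.signedIntersectionGraph.adj.rank = Nat.card E + 1 := by
  obtain ⟨hs, ⟨v⟩⟩ := Nat.card_eq_one_iff_unique.1 hG
  obtain ⟨l, hl'⟩ := Quot.exists_rep (G.rot v)
  have hv : G.rot v = (l : Cycle (E × Bool)) := hl'.symm
  have hl : l.Nodup := by have := G.nodup_rot v; rwa [hv] at this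
  have hall : ∀ h, h ∈ l := by
    intro h
    obtain ⟨w, hw, -⟩ := G.existsUnique_mem_rot h
    rw [Subsingleton.elim w v, hv] at hw
    exact hw
  cases isEmpty_or_nonempty E with
  -- Without edges there are no boundary arcs; the single face is the boundary of the isolated
  -- vertex-disc.
  | inl hE =>
    have hnil : ∀ w, G.rot w = Cycle.nil := by
      intro w
      have hnil : l = [] := List.eq_nil_iff_forall_not_mem.2 fun h => isEmptyElim h.1
      rw [Subsingleton.elim w v, hv, hnil]
      rfl
    have : IsEmpty (Quot G.BoundaryArc) := ⟨Quot.rec (fun h => isEmptyElim h.1.1) (fun h => isEmptyElim h.1.1)⟩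
    have hc : Nat.card {v : V // G.rot v = Cycle.nil} = 1 := by
      rw [Nat.card_congr (Equiv.subtypeUnivEquiv hnil)]
      exact hG
    have hr : G.signedIntersectionGraph.adj.rank = 0 := by
      have := G.signedIntersectionGraph.adj.rank_le_card_width
      simpa using this
    have : Finite V := Finite.of_subsingleton
    rw [Nat.card_sum, hc, hr]
    simp
  | inr hE =>
    obtain ⟨e⟩ := hE
    have h₀ : 0 < l.length := List.length_pos_of_mem (hall (e, false))
    have : IsEmpty {v : V // G.rot v = Cycle.nil} := by
      refine ⟨fun ⟨w, hw⟩ => ?_⟩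
      rw [Subsingleton.elim w v, hv, Cycle.coe_eq_nil] at hw
      simp [hw] at h₀
    rw [Nat.card_sum, Nat.card_of_isEmpty (α := {v : V // G.rot v = Cycle.nil}), add_zero]
    exact card_boundary_add_rank hv hl hall h₀

theorem eulerGenus_eq_rank [Fintype E] [DecidableEq E] (G : RibbonGraph V E)
    (hG : G.IsBouquet) : G.eulerGenus = (G.signedIntersectionGraph.adj.rank : ℤ) := by
  obtain ⟨hs, ⟨v⟩⟩ := Nat.card_eq_one_iff_unique.1 hG
  have hc : Nat.card G.Component = 1 :=
    Nat.card_eq_one_iff_unique.2 ⟨inferInstance, ⟨Quot.mk _ v⟩⟩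
  have hV : Nat.card V = 1 := hG
  have := card_face_add_rank G hG
  rw [eulerGenus, eulerChar, hc, hV]
  push_cast
  omega

end RibbonGraph

theorem mainTheorem5 {V E : Type*} [Fintype E] [DecidableEq E]
    (B : RibbonGraph V E) (hB : B.IsBouquet) :
    (∀ A : Finset E, (B.partialPetrial A).eulerGenus =
      ((B.partialPetrial A).signedIntersectionGraph.adj.rank : ℤ)) ∧
    B.modifiedPartialPetrialPolynomial =
      ∑ A : Finset E, (-1 : ℤ[X]) ^ A.card *
        X ^ (B.partialPetrial A).signedIntersectionGraph.adj.rank := by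
  have key : ∀ A : Finset E, (B.partialPetrial A).eulerGenus =
      ((B.partialPetrial A).signedIntersectionGraph.adj.rank : ℤ) := fun A =>
    (B.partialPetrial A).eulerGenus_eq_rank hB
  refine ⟨key, Finset.sum_congr rfl fun A _ => ?_⟩
  -- The truncation in the exponent loses nothing, since the genus equals a natural number.
  rw [key A, Int.toNat_natCast]
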